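/- Let $G\rightrightarrows M$ be a Lie groupoid with source $s$, target $t$ and units $1_x$. A \emph{$G$-path} of order $n\ge 0$ from $x$ to $y$ is a sequence $\sigma=\sigma_n g_n\sigma_{n-1}\cdots\sigma_1 g_1\sigma_0$ of piecewise smooth paths $\sigma_0,\dots,\sigma_n:[0,1]\to M$ and arrows $g_1,\dots,g_n$ of $G$ with $s(g_j)=\sigma_{j-1}(1)$, $t(g_j)=\sigma_j(0)$ for $1\le j\le n$, $\sigma_0(0)=x$ and $\sigma_n(1)=y$. Two $G$-paths from $x$ to $y$ are \emph{$G$-homotopic} if they are related by the equivalence relation generated by (i) $\cdots\sigma_{j+1}g_{j+1}\sigma_jg_j\sigma_{j-1}\cdots\sim\cdots\sigma_{j+1}(g_{j+1}g_j)\sigma_{j-1}\cdots$ if $\sigma_j$ is constant, $0<j<n$; (ii) $\cdots g_{j+1}\sigma_jg_j\sigma_{j-1}g_{j-1}\cdots\sim\cdots g_{j+1}(\sigma_j\cdot\sigma_{j-1})g_{j-1}\cdots$ if $g_j=1_{\sigma_{j-1}(1)}$, $0<j\le n$, where $\sigma_j\cdot\sigma_{j-1}$ is the concatenation (first $\sigma_{j-1}$,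 then $\sigma_j$); (iii) deformations: $\sigma\sim\sigma'$ if both have the same order $n$ and there are continuous maps $D_j:[0,1]^2\to M$ ($0\le j\le n$) and $d_j:[0,1]\to G$ ($1\le j\le n$) with $D_j(0,\cdot)=\sigma_j$, $D_j(1,\cdot)=\sigma_j'$, $d_j(0)=g_j$, $d_j(1)=g_j'$, $s(d_j(\tau))=D_{j-1}(\tau,1)$, $t(d_j(\tau))=D_j(\tau,0)$, $D_0(\tau,0)=x$ and $D_n(\tau,1)=y$ for all $\tau\in[0,1]$. The fundamental group $\Pi_1(G,x)$ is the set of $G$-homotopy classes of $G$-paths from $x$ to $x$, with the product induced by concatenation of $G$-paths. The groupoid is \emph{$G$-connected} if any two points of $M$ are joined by a $G$-path, and \emph{simply $G$-connected} if it is $G$-connected and $\Pi_1(G,x)$ is trivial for every $x\in M$. A smooth differential form $\omega$ on $M$ (in particular a smooth function) is \emph{basic} if $s^*\omega=t^*\omega$, and $$H^1_{\mathrm{bas}}(G,\mathbb R)=\frac{\{\omega\in\Omega^1(M): d\omega=0,\ s^*\omega=t^*\omega\}}{\{df: f\in C^\infty(M),\ f\circ s=f\circ t\}}$$ is the first basic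 cohomology of $G$. \textbf{Proposition.} If $G\rightrightarrows M$ is simply $G$-connected, then $H^1_{\mathrm{bas}}(G,\mathbb R)=0$. -/

import Mathlib

open Set
open scoped Manifold ContDiff

noncomputable section

/-! ## Lie groupoids -/

/-- A Lie groupoid `G ⇉ M` on the smooth manifolds `M` (objects, modelled on `EM`) and `G` (arrows,
modelled on `EG`).  An arrow `g` goes from `src g` to `tgt g`, and `mul g h` is the composite
`g ∘ h`, which is meaningful only if `src g = tgt h`; the values of `mul` on other pairs play no
role. Source and target are submersions, so the set of composable pairs is an embedded submanifold
of `G × G`, and smoothness of `mul` on this submanifold is `ContMDiffOn` on that set. -/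
structure LieGroupoid (EM EG M G : Type*)
    [NormedAddCommGroup EM] [NormedSpace ℝ EM] [NormedAddCommGroup EG] [NormedSpace ℝ EG]
    [TopologicalSpace M] [ChartedSpace EM M] [TopologicalSpace G] [ChartedSpace EG G] where
  src : G → M
  tgt : G → M
  mul : G → G → G
  unit : M → G
  inv : G → G
  src_mul : ∀ g h, src g = tgt h → src (mul g h) = src h
  tgt_mul : ∀ g h, src g = tgt h → tgt (mul g h) = tgt g
  mul_assoc : ∀ g h k, src g = tgt h → src h = tgt k → mul (mul g h) k = mul g (mul h k)
  src_unit : ∀ x, src (unit x) = x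
  tgt_unit : ∀ x, tgt (unit x) = x
  mul_unit : ∀ g, mul g (unit (src g)) = g
  unit_mul : ∀ g, mul (unit (tgt g)) g = g
  src_inv : ∀ g, src (inv g) = tgt g
  tgt_inv : ∀ g, tgt (inv g) = src g
  mul_inv : ∀ g, mul g (inv g) = unit (tgt g)
  inv_mul : ∀ g, mul (inv g) g = unit (src g)
  smooth_src : ContMDiff 𝓘(ℝ, EG) 𝓘(ℝ, EM) ∞ src
  smooth_tgt : ContMDiff 𝓘(ℝ, EG) 𝓘(ℝ, EM) ∞ tgt
  smooth_unit : ContMDiff 𝓘(ℝ, EM) 𝓘(ℝ, EG) ∞ unit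
  smooth_inv : ContMDiff 𝓘(ℝ, EG) 𝓘(ℝ, EG) ∞ inv
  smooth_mul : ContMDiffOn (𝓘(ℝ, EG).prod 𝓘(ℝ, EG)) 𝓘(ℝ, EG) ∞
    (fun p : G × G => mul p.1 p.2) {p : G × G | src p.1 = tgt p.2}
  submersion_src : Manifold.IsSubmersion 𝓘(ℝ, EG) 𝓘(ℝ, EM) ∞ src
  submersion_tgt : Manifold.IsSubmersion 𝓘(ℝ, EG) 𝓘(ℝ, EM) ∞ tgt

/-! ## Paths -/

/-- A path `[0,1] → M` is piecewise smooth if it is continuous and there are finitely many points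
such that it is smooth on each closed subinterval without such a point in its interior. -/
def IsPiecewiseSmooth (EM : Type*) {M : Type*} [NormedAddCommGroup EM] [NormedSpace ℝ EM]
    [TopologicalSpace M] [ChartedSpace EM M] (γ : C(unitInterval, M)) : Prop :=
  ∃ F : Finset ℝ, ∀ a b : ℝ, 0 ≤ a → a < b → b ≤ 1 → (∀ c ∈ F, c ∉ Ioo a b) →
    ContMDiffOn 𝓘(ℝ, ℝ) 𝓘(ℝ, EM) ∞ (IccExtend zero_le_one γ) (Icc a b)

/-- The standard concatenation: first `γ`, then `δ`, both at double speed. -/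
def concatPath {M : Type*} [TopologicalSpace M] (γ δ : C(unitInterval, M)) (h : γ 1 = δ 0) : C(unitInterval, M) :=
  ((Path.mk γ rfl rfl).trans (Path.mk δ h.symm rfl) : Path (γ 0) (δ 1)).toContinuousMap

namespace LieGroupoid

variable {EM EG M G : Type*}
  [NormedAddCommGroup EM] [NormedSpace ℝ EM] [NormedAddCommGroup EG] [NormedSpace ℝ EG]
  [TopologicalSpace M] [ChartedSpace EM M] [TopologicalSpace G] [ChartedSpace EG G]

/-- The data `σₙ gₙ ⋯ σ₁ g₁ σ₀` of a `G`-path: the path `σ₀` and the list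
`[(g₁, σ₁), …, (gₙ, σₙ)]`, whose length is the order `n`. -/
@[ext] structure RawPath (M G : Type*) [TopologicalSpace M] where
  head : C(unitInterval, M)
  tail : List (G × C(unitInterval, M))

/-- `𝒢.IsChain p [(g₁, σ₁), …, (gₙ, σₙ)] y`: the arrow `g₁` starts at `p`, each `gⱼ` ends at the
start of `σⱼ`, the next arrow starts at the end of `σⱼ`, and `σₙ` ends at `y`
(for `n = 0`: `p = y`). -/
def IsChain (𝒢 : LieGroupoid EM EG M G) : M → List (G × C(unitInterval, M)) → M → Prop
  | p, [], y => p = y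
  | p, (g, σ) :: l, y => 𝒢.src g = p ∧ 𝒢.tgt g = σ 0 ∧ 𝒢.IsChain (σ 1) l y

/-- `σₙ gₙ ⋯ g₁ σ₀` is a chain of continuous paths and arrows from `x` to `y`. -/
def IsChainPath (𝒢 : LieGroupoid EM EG M G) (x y : M) (σ : RawPath M G) : Prop :=
  σ.head 0 = x ∧ 𝒢.IsChain (σ.head 1) σ.tail y

/-- The `G`-paths from `x` to `y`: the arrow `gⱼ` goes from `σⱼ₋₁(1)` to `σⱼ(0)`, and all `σⱼ` are
piecewise smooth. -/
def GPath (𝒢 : LieGroupoid EM EG M G) (x y : M) : Type _ :=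
  {σ : RawPath M G // 𝒢.IsChainPath x y σ ∧
    IsPiecewiseSmooth EM σ.head ∧ ∀ p ∈ σ.tail, IsPiecewiseSmooth EM p.2}

/-- The elementary equivalences of `G`-paths. -/
inductive ElemEquiv (𝒢 : LieGroupoid EM EG M G) : RawPath M G → RawPath M G → Prop
  /-- Multiplication: `⋯ σ g₂ c g₁ ⋯ ∼ ⋯ σ (g₂ g₁) ⋯` for a constant path `c`. -/
  | mul (σ₀ : C(unitInterval, M)) (A : List (G × C(unitInterval, M))) (g₁ : G) (c : C(unitInterval, M)) (g₂ : G) (σ : C(unitInterval, M))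
      (B : List (G × C(unitInterval, M))) (hc : ∀ τ, c τ = c 0) :
      ElemEquiv 𝒢 ⟨σ₀, A ++ (g₁, c) :: (g₂, σ) :: B⟩ ⟨σ₀, A ++ (𝒢.mul g₂ g₁, σ) :: B⟩
  /-- Concatenation at the first path: `⋯ σ₁ 1 σ₀ ∼ ⋯ (σ₁ · σ₀)`. -/
  | concat_head (σ₀ σ₁ : C(unitInterval, M)) (B : List (G × C(unitInterval, M))) (h : σ₀ 1 = σ₁ 0) :
      ElemEquiv 𝒢 ⟨σ₀, (𝒢.unit (σ₀ 1), σ₁) :: B⟩ ⟨concatPath σ₀ σ₁ h, B⟩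
  /-- Concatenation at a later path: `⋯ σ' 1 σ g ⋯ ∼ ⋯ (σ' · σ) g ⋯`. -/
  | concat_tail (σ₀ : C(unitInterval, M)) (A : List (G × C(unitInterval, M))) (g : G) (σ σ' : C(unitInterval, M))
      (B : List (G × C(unitInterval, M))) (h : σ 1 = σ' 0) :
      ElemEquiv 𝒢 ⟨σ₀, A ++ (g, σ) :: (𝒢.unit (σ 1), σ') :: B⟩
        ⟨σ₀, A ++ (g, concatPath σ σ' h) :: B⟩

/-- The data `Dₙ dₙ ⋯ d₁ D₀` of a continuous family of `G`-paths of a fixed order, with `Dⱼ(τ, ν)`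
for the family parameter `τ` and the path parameter `ν`. -/
structure RawFamily (M G : Type*) [TopologicalSpace M] [TopologicalSpace G] where
  head : C(unitInterval × unitInterval, M)
  tail : List (C(unitInterval, G) × C(unitInterval × unitInterval, M))

/-- The member `Dₙ(τ, ·) dₙ(τ) ⋯ d₁(τ) D₀(τ, ·)` of a family. -/
def RawFamily.slice (D : RawFamily M G) (τ : unitInterval) : RawPath M G :=
  ⟨D.head.curry τ, D.tail.map fun p => (p.1 τ, p.2.curry τ)⟩

/-- `D` is a deformation from `σ` to `σ'` with fixed end points `x` and `y`. -/
def IsDeformation (𝒢 : LieGroupoid EM EG M G) (x y : M) (D : RawFamily M G)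
    (σ σ' : RawPath M G) : Prop :=
  (∀ τ, 𝒢.IsChainPath x y (D.slice τ)) ∧ D.slice 0 = σ ∧ D.slice 1 = σ'

/-- One step of a `G`-homotopy: an elementary equivalence or a deformation. -/
def HomotopyStep (𝒢 : LieGroupoid EM EG M G) (x y : M) (σ σ' : 𝒢.GPath x y) : Prop :=
  𝒢.ElemEquiv σ.1 σ'.1 ∨ ∃ D : RawFamily M G, 𝒢.IsDeformation x y D σ.1 σ'.1

/-- `G`-homotopy of `G`-paths with fixed end points: the equivalence relation generated by the
elementary equivalences and the deformations. -/
def GHomotopic (𝒢 : LieGroupoid EM EG M G) (x y : M) : Setoid (𝒢.GPath x y) :=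
  Relation.EqvGen.setoid (𝒢.HomotopyStep x y)

/-- The set of arrows from `x` to `y` of the fundamental groupoid of `G`; for `x = y` it is
(the underlying set of) the fundamental group of `G` at `x`. -/
def Pi1 (𝒢 : LieGroupoid EM EG M G) (x y : M) : Type _ :=
  Quotient (𝒢.GHomotopic x y)

/-- Any two points are joined by a `G`-path. -/
def GConnected (𝒢 : LieGroupoid EM EG M G) : Prop :=
  ∀ x y : M, Nonempty (𝒢.GPath x y)

/-- `G` is `G`-connected with trivial fundamental groups. -/
def SimplyGConnected (𝒢 : LieGroupoid EM EG M G) : Prop :=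
  𝒢.GConnected ∧ ∀ x : M, Subsingleton (𝒢.Pi1 x x)

end LieGroupoid

/-! ## Differential 1-forms -/

/-- Smooth 1-forms on `M`: smooth sections of the cotangent bundle. -/
abbrev OneForm (EM M : Type*) [NormedAddCommGroup EM] [NormedSpace ℝ EM]
    [TopologicalSpace M] [ChartedSpace EM M] [IsManifold 𝓘(ℝ, EM) ∞ M] : Type _ :=
  ContMDiffSection 𝓘(ℝ, EM) (EM →L[ℝ] ℝ) ∞
    (fun x : M => TangentSpace 𝓘(ℝ, EM) x →L[ℝ] Bundle.Trivial M ℝ x)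

namespace OneForm

variable {EM M : Type*} [NormedAddCommGroup EM] [NormedSpace ℝ EM]
    [TopologicalSpace M] [ChartedSpace EM M] [IsManifold 𝓘(ℝ, EM) ∞ M]

/-- The value of a 1-form at a point, as a linear form on the tangent space. -/
def eval (θ : OneForm EM M) (x : M) : TangentSpace 𝓘(ℝ, EM) x →L[ℝ] ℝ := θ x

/-- The local expression of `θ` in the chart `φ` at `x₀`: the 1-form `(φ⁻¹)^* θ`. -/
def inChart (θ : OneForm EM M) (x₀ : M) (v : EM) : EM →L[ℝ] ℝ :=
  (θ.eval ((extChartAt 𝓘(ℝ, EM) x₀).symm v)).comp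
    (mfderiv 𝓘(ℝ, EM) 𝓘(ℝ, EM) (extChartAt 𝓘(ℝ, EM) x₀).symm v)

theorem contDiffOn_inChart (θ : OneForm EM M) (x₀ : M) :
    ContDiffOn ℝ ∞ (θ.inChart x₀) (extChartAt 𝓘(ℝ, EM) x₀).target := by
  set e := trivializationAt (EM →L[ℝ] ℝ)
    (fun x : M => TangentSpace 𝓘(ℝ, EM) x →L[ℝ] Bundle.Trivial M ℝ x) x₀ with he
  have h1 := (e.contMDiffOn_section_baseSet_iff (IB := 𝓘(ℝ, EM)) (n := ∞)
    (s := fun x => θ x)).1 θ.contMDiff.contMDiffOn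
  have hsub : MapsTo (extChartAt 𝓘(ℝ, EM) x₀).symm (extChartAt 𝓘(ℝ, EM) x₀).target e.baseSet := by
    intro v hv
    have := (extChartAt 𝓘(ℝ, EM) x₀).map_target hv
    simpa [he, extChartAt_source] using this
  have h2 := h1.comp (contMDiffOn_extChartAt_symm x₀) hsub
  rw [contMDiffOn_iff_contDiffOn] at h2
  refine h2.congr fun v hv => ?_
  have hx := (extChartAt 𝓘(ℝ, EM) x₀).map_target hv
  rw [extChartAt_source] at hx
  have h3 := TangentBundle.symmL_trivializationAt (I := 𝓘(ℝ, EM)) hx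
  rw [(extChartAt 𝓘(ℝ, EM) x₀).right_inv hv] at h3
  simp only [modelWithCornersSelf_coe, range_id, mfderivWithin_univ] at h3
  ext w
  simp only [Function.comp, he, hom_trivializationAt_apply, ContinuousLinearMap.inCoordinates,
    inChart, eval]
  rw [h3]
  have h4 := Bundle.Trivial.continuousLinearMapAt_trivialization ℝ M ℝ
    ((extChartAt 𝓘(ℝ, EM) x₀).symm v)
  exact (DFunLike.congr_fun h4 _).symm

theorem differentiableAt_inChart (θ : OneForm EM M) (x₀ : M) {v : EM}
    (hv : v ∈ (extChartAt 𝓘(ℝ, EM) x₀).target) : DifferentiableAt ℝ (θ.inChart x₀) v :=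
  ((θ.contDiffOn_inChart x₀).differentiableOn (by simp)).differentiableAt
    ((isOpen_extChartAt_target x₀).mem_nhds hv)

/-- `θ` is closed: `dθ = 0`, where in a chart `dθ (u, w) = D_u θ (w) - D_w θ (u)`. -/
def IsClosedForm (θ : OneForm EM M) : Prop :=
  ∀ x₀ : M, ∀ v ∈ (extChartAt 𝓘(ℝ, EM) x₀).target, ∀ u w : EM,
    fderiv ℝ (θ.inChart x₀) v u w - fderiv ℝ (θ.inChart x₀) v w u = 0

theorem eval_add (θ η : OneForm EM M) (x : M) : (θ + η).eval x = θ.eval x + η.eval x := rfl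

theorem eval_smul (c : ℝ) (θ : OneForm EM M) (x : M) : (c • θ).eval x = c • θ.eval x := rfl

theorem eval_zero (x : M) : (0 : OneForm EM M).eval x = 0 := rfl

theorem inChart_add (θ η : OneForm EM M) (x₀ : M) :
    (θ + η).inChart x₀ = θ.inChart x₀ + η.inChart x₀ := by
  funext v; exact ContinuousLinearMap.add_comp _ _ _

theorem inChart_smul (c : ℝ) (θ : OneForm EM M) (x₀ : M) :
    (c • θ).inChart x₀ = c • θ.inChart x₀ := by
  funext v; exact ContinuousLinearMap.smul_comp _ _ _

theorem inChart_zero (x₀ : M) : (0 : OneForm EM M).inChart x₀ = 0 := by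
  funext v; exact ContinuousLinearMap.zero_comp _

end OneForm

/-! ## Basic cohomology in degree 1 -/

namespace LieGroupoid

variable {EM EG M G : Type*}
  [NormedAddCommGroup EM] [NormedSpace ℝ EM] [NormedAddCommGroup EG] [NormedSpace ℝ EG]
  [TopologicalSpace M] [ChartedSpace EM M] [TopologicalSpace G] [ChartedSpace EG G]

/-- A function `f` on `M` is basic if `s^* f = t^* f`. -/
def IsBasicFun (𝒢 : LieGroupoid EM EG M G) (f : M → ℝ) : Prop :=
  ∀ g : G, f (𝒢.src g) = f (𝒢.tgt g)

variable [IsManifold 𝓘(ℝ, EM) ∞ M]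

/-- A 1-form `θ` on `M` is basic if `s^* θ = t^* θ`. -/
def IsBasicForm (𝒢 : LieGroupoid EM EG M G) (θ : OneForm EM M) : Prop :=
  ∀ g : G, (θ.eval (𝒢.src g)).comp (mfderiv 𝓘(ℝ, EG) 𝓘(ℝ, EM) 𝒢.src g) =
    (θ.eval (𝒢.tgt g)).comp (mfderiv 𝓘(ℝ, EG) 𝓘(ℝ, EM) 𝒢.tgt g)

/-- The real vector space of closed basic 1-forms. -/
def closedBasicForms (𝒢 : LieGroupoid EM EG M G) : Submodule ℝ (OneForm EM M) where
  carrier := {θ | 𝒢.IsBasicForm θ ∧ θ.IsClosedForm}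
  zero_mem' := by
    refine ⟨fun g => ?_, fun x₀ v _ u w => ?_⟩
    · simp only [OneForm.eval_zero, ContinuousLinearMap.zero_comp]
    · simp [OneForm.inChart_zero]
  add_mem' := by
    rintro θ η ⟨hθ, hθ'⟩ ⟨hη, hη'⟩
    refine ⟨fun g => ?_, fun x₀ v hv u w => ?_⟩
    · simp only [OneForm.eval_add, ContinuousLinearMap.add_comp, hθ g, hη g]
    · rw [OneForm.inChart_add, fderiv_add (θ.differentiableAt_inChart x₀ hv)
        (η.differentiableAt_inChart x₀ hv)]
      have h1 := hθ' x₀ v hv u w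
      have h2 := hη' x₀ v hv u w
      simp only [add_apply]
      linarith
  smul_mem' := by
    rintro c θ ⟨hθ, hθ'⟩
    refine ⟨fun g => ?_, fun x₀ v hv u w => ?_⟩
    · simp only [OneForm.eval_smul, ContinuousLinearMap.smul_comp, hθ g]
    · rw [OneForm.inChart_smul, fderiv_const_smul (θ.differentiableAt_inChart x₀ hv)]
      have h1 := hθ' x₀ v hv u w
      simp only [smul_apply, smul_eq_mul, ← mul_sub, h1, mul_zero]

/-- The subspace of those closed basic 1-forms that are the differential `df` of a smooth basic
function `f`. -/
def exactBasicForms (𝒢 : LieGroupoid EM EG M G) : Submodule ℝ 𝒢.closedBasicForms where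
  carrier := {θ | ∃ f : M → ℝ, ContMDiff 𝓘(ℝ, EM) 𝓘(ℝ, ℝ) ∞ f ∧ 𝒢.IsBasicFun f ∧
    ∀ x, θ.1.eval x = mfderiv 𝓘(ℝ, EM) 𝓘(ℝ, ℝ) f x}
  zero_mem' := by
    refine ⟨fun _ => 0, contMDiff_const, fun _ => rfl, fun x => ?_⟩
    rw [mfderiv_const]
    rfl
  add_mem' := by
    rintro θ η ⟨f, hf, hf', hfd⟩ ⟨k, hk, hk', hkd⟩
    refine ⟨f + k, hf.add hk, fun g => congrArg₂ (· + ·) (hf' g) (hk' g), fun x => ?_⟩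
    have h1 := mfderiv_add (hf.mdifferentiableAt (by simp) (x := x))
      (hk.mdifferentiableAt (by simp) (x := x))
    rw [h1]
    exact congrArg₂ (· + ·) (hfd x) (hkd x)
  smul_mem' := by
    rintro c θ ⟨f, hf, hf', hfd⟩
    have hc : ContMDiff 𝓘(ℝ, EM) 𝓘(ℝ, ℝ) ∞ (fun x => c * f x) := contMDiff_const.mul hf
    refine ⟨c • f, hc, fun g => congrArg (c • ·) (hf' g), fun x => ?_⟩
    have h1 := const_smul_mfderiv (hf.mdifferentiableAt (by simp) (x := x)) c
    rw [h1]
    exact congrArg (c • ·) (hfd x)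

/-- The first basic cohomology `H¹_bas(G, ℝ)`: closed basic 1-forms modulo differentials of smooth
basic functions. -/
abbrev BasicH1 (𝒢 : LieGroupoid EM EG M G) : Type _ :=
  𝒢.closedBasicForms ⧸ 𝒢.exactBasicForms

end LieGroupoid

end

/-! Integrate a closed basic form `θ` along `G`-paths, letting arrows contribute nothing. If the
integral depends only on the end points, then integrating from a base point gives a function `f`
with `df = θ`. It is basic because following an arrow `g` by a constant path adds nothing to the
integral.

Path independence reduces to invariance under `G`-homotopy, since all loops are homotopic to
constant ones. Elementary equivalences are harmless (`ElemEquiv.integral_eq`). The substance is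
invariance under deformations, which are only continuous. The integral is therefore defined without
derivatives, as the increment of a primitive along the path, that is, a function that is locally a
local primitive of `θ` composed with the path. Such primitives exist over the whole square
(`IsClosedForm.exists_isPrimitiveAlong`), so each `Dⱼ` has a primitive `Fⱼ`, and the integral of the
slice at `τ` is the sum of the `Fⱼ(τ,1) - Fⱼ(τ,0)`. Since `s^*θ = t^*θ`, the difference `Fⱼ₋₁(τ,1) -
Fⱼ(τ,0)` across the arrow `dⱼ(τ)` takes the same value at `τ = 0` and `τ = 1`
(`IsBasicForm.sub_eq_sub`). With the outer end points fixed, the sum telescopes to equal values at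
both ends of the deformation. -/

noncomputable section

open Filter Topology

/-! ### Calculus in charts -/

section LocalCalculus

variable {E N : Type*} [NormedAddCommGroup E] [NormedSpace ℝ E]
  [TopologicalSpace N] [ChartedSpace E N] [IsManifold 𝓘(ℝ, E) ∞ N]

theorem hasMFDerivAt_extChartAt_symm {x : N} {v : E} (hv : v ∈ (extChartAt 𝓘(ℝ, E) x).target) :
    HasMFDerivAt 𝓘(ℝ, E) 𝓘(ℝ, E) (extChartAt 𝓘(ℝ, E) x).symm v
      (mfderiv 𝓘(ℝ, E) 𝓘(ℝ, E) (extChartAt 𝓘(ℝ, E) x).symm v) := by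
  have h := (contMDiffOn_extChartAt_symm (I := 𝓘(ℝ, E)) (n := ∞) x).contMDiffAt
    ((isOpen_extChartAt_target x).mem_nhds hv)
  exact (h.mdifferentiableAt (by simp)).hasMFDerivAt

/-- The differentials of a chart and of its inverse cancel. This recovers `θ` from its local
expression in the Poincaré lemma. -/
theorem ContinuousLinearMap.comp_mfderiv_extChartAt_symm_comp {x y : N}
    (hy : y ∈ (extChartAt 𝓘(ℝ, E) x).source) (L : TangentSpace 𝓘(ℝ, E) y →L[ℝ] ℝ) :
    (L.comp (mfderiv 𝓘(ℝ, E) 𝓘(ℝ, E) (extChartAt 𝓘(ℝ, E) x).symm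
      (extChartAt 𝓘(ℝ, E) x y))).comp (mfderiv 𝓘(ℝ, E) 𝓘(ℝ, E) (extChartAt 𝓘(ℝ, E) x) y) = L := by
  have h := mfderivWithin_extChartAt_symm_comp_mfderiv_extChartAt' (I := 𝓘(ℝ, E)) hy
  simp only [modelWithCornersSelf_coe, range_id, mfderivWithin_univ] at h
  ext w
  exact congrArg L (DFunLike.congr_fun h w)

/-- Two functions with the same differential near a point differ by a constant near that point. -/
theorem eventually_sub_eq_of_hasMFDerivAt {a b : N → ℝ} {x : N}
    {L : ∀ y : N, TangentSpace 𝓘(ℝ, E) y →L[ℝ] ℝ}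
    (ha : ∀ᶠ y in 𝓝 x, HasMFDerivAt 𝓘(ℝ, E) 𝓘(ℝ, ℝ) a y (L y))
    (hb : ∀ᶠ y in 𝓝 x, HasMFDerivAt 𝓘(ℝ, E) 𝓘(ℝ, ℝ) b y (L y)) :
    ∀ᶠ y in 𝓝 x, a y - b y = a x - b x := by
  set e := extChartAt 𝓘(ℝ, E) x with he
  have hx : e.symm (e x) = x := extChartAt_to_inv x
  have hc : ContinuousAt e.symm (e x) := continuousAt_extChartAt_symm x
  have h1 : ∀ᶠ v in 𝓝 (e x), HasMFDerivAt 𝓘(ℝ, E) 𝓘(ℝ, ℝ) a (e.symm v) (L (e.symm v)) :=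
    hc.eventually (by rw [hx]; exact ha)
  have h2 : ∀ᶠ v in 𝓝 (e x), HasMFDerivAt 𝓘(ℝ, E) 𝓘(ℝ, ℝ) b (e.symm v) (L (e.symm v)) :=
    hc.eventually (by rw [hx]; exact hb)
  have h3 : ∀ᶠ v in 𝓝 (e x), v ∈ e.target := extChartAt_target_mem_nhds x
  obtain ⟨r, hr, hball⟩ := Metric.mem_nhds_iff.1 ((h1.and h2).and h3)
  have hD : ∀ v ∈ Metric.ball (e x) r,
      HasFDerivAt (fun v => a (e.symm v) - b (e.symm v)) (0 : E →L[ℝ] ℝ) v := by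
    intro v hv
    obtain ⟨⟨ha', hb'⟩, ht⟩ := hball hv
    have hs := hasMFDerivAt_extChartAt_symm ht
    have h := (ha'.comp v hs).hasFDerivAt.sub (hb'.comp v hs).hasFDerivAt
    -- Stated over the model space because the tangent spaces involved are only definitionally equal
    -- to it.
    have h0 : ∀ A : E →L[ℝ] ℝ, A - A = 0 := fun A => sub_self A
    exact h.congr_fderiv (h0 _)
  have hconst : ∀ v ∈ Metric.ball (e x) r,
      a (e.symm v) - b (e.symm v) = a (e.symm (e x)) - b (e.symm (e x)) := by
    intro v hv
    refine (convex_ball (e x) r).is_const_of_fderivWithin_eq_zero (𝕜 := ℝ)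
      (f := fun v => a (e.symm v) - b (e.symm v))
      (fun w hw => (hD w hw).differentiableAt.differentiableWithinAt) (fun w hw => ?_) hv
      (Metric.mem_ball_self hr)
    rw [fderivWithin_of_isOpen Metric.isOpen_ball hw, (hD w hw).fderiv]
  have h4 : ∀ᶠ y in 𝓝 x, e y ∈ Metric.ball (e x) r :=
    (continuousAt_extChartAt x).eventually (Metric.ball_mem_nhds _ hr)
  filter_upwards [h4, extChartAt_source_mem_nhds (I := 𝓘(ℝ, E)) x] with y hy hys
  have := hconst _ hy
  rwa [hx, e.left_inv hys] at this

/-- All points near `x` are joined to `x` by a piecewise smooth path in a given neighbourhood. -/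
theorem eventually_exists_isPiecewiseSmooth {x : N} {U : Set N} (hU : U ∈ 𝓝 x) :
    ∀ᶠ y in 𝓝 x, ∃ γ : C(unitInterval, N), IsPiecewiseSmooth E γ ∧ γ 0 = x ∧ γ 1 = y ∧
      ∀ τ, γ τ ∈ U := by
  set e := extChartAt 𝓘(ℝ, E) x with he
  have hx : e.symm (e x) = x := extChartAt_to_inv x
  have h1 : ∀ᶠ v in 𝓝 (e x), e.symm v ∈ U :=
    (continuousAt_extChartAt_symm x).eventually (by rwa [hx])
  have h3 : ∀ᶠ v in 𝓝 (e x), v ∈ e.target := extChartAt_target_mem_nhds x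
  obtain ⟨r, hr, hball⟩ := Metric.mem_nhds_iff.1 (h1.and h3)
  have h4 : ∀ᶠ y in 𝓝 x, e y ∈ Metric.ball (e x) r :=
    (continuousAt_extChartAt x).eventually (Metric.ball_mem_nhds _ hr)
  filter_upwards [h4, extChartAt_source_mem_nhds (I := 𝓘(ℝ, E)) x] with y hy hys
  -- The path is a straight segment in the chart, inside a ball that `e.symm` maps into `U`; no
  -- break points are needed.
  set l : ℝ → E := fun t => AffineMap.lineMap (e x) (e y) t with hl
  have hls : ContDiff ℝ ∞ l := by
    simp only [hl, AffineMap.lineMap_apply_module']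
    fun_prop
  have hmem : ∀ t ∈ Icc (0 : ℝ) 1, l t ∈ Metric.ball (e x) r := fun t ht =>
    (convex_ball (e x) r).lineMap_mem (Metric.mem_ball_self hr) hy ht
  have hsm : ContMDiffOn 𝓘(ℝ, ℝ) 𝓘(ℝ, E) ∞ (fun t => e.symm (l t)) (Icc 0 1) :=
    (contMDiffOn_extChartAt_symm (n := ∞) x).comp hls.contMDiff.contMDiffOn
      fun t ht => (hball (hmem t ht)).2
  refine ⟨⟨fun t => e.symm (l t), hsm.continuousOn.comp_continuous continuous_subtype_val
    fun t => t.2⟩, ⟨∅, fun a b ha hab hb _ => ?_⟩, ?_, ?_, fun t => (hball (hmem t t.2)).1⟩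
  · refine (hsm.mono (Icc_subset_Icc ha hb)).congr fun t ht => ?_
    rw [IccExtend_of_mem _ _ (Icc_subset_Icc ha hb ht)]
    rfl
  · simp [hl, hx]
  · simp [hl, e.left_inv hys]

end LocalCalculus

/-! ### Local primitives of closed 1-forms -/

namespace OneForm

variable {EM M : Type*} [NormedAddCommGroup EM] [NormedSpace ℝ EM]
    [TopologicalSpace M] [ChartedSpace EM M] [IsManifold 𝓘(ℝ, EM) ∞ M]

/-- `φ` is a primitive of `θ` near `x`. -/
def IsPrimitiveAt (θ : OneForm EM M) (φ : M → ℝ) (x : M) : Prop :=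
  ∀ᶠ y in 𝓝 x, HasMFDerivAt 𝓘(ℝ, EM) 𝓘(ℝ, ℝ) φ y (θ.eval y)

/-- The Poincaré lemma for 1-forms. -/
theorem IsClosedForm.exists_isPrimitiveAt {θ : OneForm EM M} (hθ : θ.IsClosedForm) (x : M) :
    ∃ φ, θ.IsPrimitiveAt φ x := by
  set e := extChartAt 𝓘(ℝ, EM) x with he
  obtain ⟨r, hr, hball⟩ := Metric.mem_nhds_iff.1 (extChartAt_target_mem_nhds (I := 𝓘(ℝ, EM)) x)
  -- Closedness is symmetry of the derivative of the local expression, so the Poincaré lemma on a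
  -- convex open set applies.
  obtain ⟨ψ, hψ⟩ := (convex_ball (e x) r).exists_forall_hasFDerivAt_of_fderiv_symmetric
    Metric.isOpen_ball
    (fun v hv => (θ.differentiableAt_inChart x (hball hv)).differentiableWithinAt)
    (fun v hv u w => sub_eq_zero.1 (hθ x v (hball hv) u w))
  refine ⟨fun y => ψ (e y), ?_⟩
  have h4 : ∀ᶠ y in 𝓝 x, e y ∈ Metric.ball (e x) r :=
    (continuousAt_extChartAt x).eventually (Metric.ball_mem_nhds _ hr)
  filter_upwards [h4, extChartAt_source_mem_nhds (I := 𝓘(ℝ, EM)) x] with y hy hys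
  have h5 : HasMFDerivAt 𝓘(ℝ, EM) 𝓘(ℝ, EM) e y (mfderiv 𝓘(ℝ, EM) 𝓘(ℝ, EM) e y) :=
    (mdifferentiableAt_extChartAt (by simpa using hys)).hasMFDerivAt
  have h6 := (hψ _ hy).hasMFDerivAt.comp y h5
  have h7 := ContinuousLinearMap.comp_mfderiv_extChartAt_symm_comp hys (θ.eval y)
  have h8 : θ.inChart x (e y) = (θ.eval y).comp (mfderiv 𝓘(ℝ, EM) 𝓘(ℝ, EM) e.symm (e y)) := by
    unfold inChart
    rw [← he, e.left_inv hys]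
    rfl
  rw [h8] at h6
  exact h7 ▸ h6

/-- A function whose differential is a smooth 1-form is smooth. -/
theorem contMDiff_of_hasMFDerivAt {θ : OneForm EM M} {f : M → ℝ}
    (hf : ∀ x, HasMFDerivAt 𝓘(ℝ, EM) 𝓘(ℝ, ℝ) f x (θ.eval x)) :
    ContMDiff 𝓘(ℝ, EM) 𝓘(ℝ, ℝ) ∞ f := by
  intro x
  have hd : ∀ v ∈ (extChartAt 𝓘(ℝ, EM) x).target,
      HasFDerivAt (f ∘ (extChartAt 𝓘(ℝ, EM) x).symm) (θ.inChart x v) v := fun v hv =>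
    ((hf _).comp v (hasMFDerivAt_extChartAt_symm hv)).hasFDerivAt
  have ho := isOpen_extChartAt_target (I := 𝓘(ℝ, EM)) x
  have h : ContDiffOn ℝ ∞ (f ∘ (extChartAt 𝓘(ℝ, EM) x).symm) (extChartAt 𝓘(ℝ, EM) x).target := by
    -- In the chart the derivative of `f` is the local expression of `θ`, which is already smooth.
    rw [contDiffOn_infty_iff_fderiv_of_isOpen ho]
    exact ⟨fun v hv => (hd v hv).differentiableAt.differentiableWithinAt,
      (θ.contDiffOn_inChart x).congr fun v hv => (hd v hv).fderiv⟩
  rw [contMDiffAt_iff_source]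
  exact (h.contDiffAt (extChartAt_target_mem_nhds x)).contMDiffAt.contMDiffWithinAt

end OneForm

/-- A function that is locally constant within a preconnected set is constant on it. -/
theorem IsPreconnected.eq_of_eventually_eq {X Y : Type*} [TopologicalSpace X] {S : Set X}
    (hS : IsPreconnected S) {h : X → Y} (hh : ∀ x ∈ S, ∀ᶠ y in 𝓝[S] x, h y = h x)
    {x y : X} (hx : x ∈ S) (hy : y ∈ S) : h y = h x :=
  hS.induction₂ (fun a b => h b = h a) hh (fun _ _ _ _ _ _ h1 h2 => h2.trans h1)
    (fun _ _ _ _ h1 => h1.symm) hx hy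

/-! ### Primitives along continuous maps, and their gluing -/

namespace OneForm

variable {EM M : Type*} [NormedAddCommGroup EM] [NormedSpace ℝ EM]
    [TopologicalSpace M] [ChartedSpace EM M] [IsManifold 𝓘(ℝ, EM) ∞ M]

theorem IsPrimitiveAt.eventually {θ : OneForm EM M} {φ : M → ℝ} {x : M}
    (h : θ.IsPrimitiveAt φ x) : ∀ᶠ y in 𝓝 x, θ.IsPrimitiveAt φ y :=
  eventually_eventually_nhds.2 h

theorem IsPrimitiveAt.add_const {θ : OneForm EM M} {φ : M → ℝ} {x : M}
    (h : θ.IsPrimitiveAt φ x) (c : ℝ) : θ.IsPrimitiveAt (fun y => φ y + c) x := by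
  filter_upwards [h] with y hy
  have h1 := hy.add (hasMFDerivAt_const (I := 𝓘(ℝ, EM)) (I' := 𝓘(ℝ, ℝ)) c y)
  have h0 : ∀ A : EM →L[ℝ] ℝ, A + 0 = A := fun A => add_zero A
  exact (h0 (θ.eval y)) ▸ h1

theorem IsPrimitiveAt.eventually_sub_eq {θ : OneForm EM M} {φ ψ : M → ℝ} {x : M}
    (hφ : θ.IsPrimitiveAt φ x) (hψ : θ.IsPrimitiveAt ψ x) :
    ∀ᶠ y in 𝓝 x, φ y - ψ y = φ x - ψ x :=
  eventually_sub_eq_of_hasMFDerivAt hφ hψ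

/-- `F` is a primitive of `θ` along the map `u` on `S`: locally it is the composite of `u` with a
local primitive of `θ`. -/
def IsPrimitiveAlong {X : Type*} [TopologicalSpace X] (θ : OneForm EM M) (u : X → M) (F : X → ℝ)
    (S : Set X) : Prop :=
  ∀ x ∈ S, ∃ φ, θ.IsPrimitiveAt φ (u x) ∧ F =ᶠ[𝓝[S] x] φ ∘ u

section Along

variable {X Y : Type*} [TopologicalSpace X] [TopologicalSpace Y] {θ : OneForm EM M} {u : X → M}
  {F F' : X → ℝ} {S T : Set X}

theorem IsPrimitiveAlong.mono (h : θ.IsPrimitiveAlong u F S) (hT : T ⊆ S) :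
    θ.IsPrimitiveAlong u F T := fun x hx =>
  let ⟨φ, h1, h2⟩ := h x (hT hx)
  ⟨φ, h1, h2.filter_mono (nhdsWithin_mono x hT)⟩

theorem IsPrimitiveAlong.comp {u : X → M} (h : θ.IsPrimitiveAlong u F univ) {v : Y → X}
    (hv : Continuous v) : θ.IsPrimitiveAlong (u ∘ v) (F ∘ v) univ := fun y _ => by
  obtain ⟨φ, h1, h2⟩ := h (v y) (mem_univ _)
  rw [nhdsWithin_univ] at h2
  exact ⟨φ, h1, by rw [nhdsWithin_univ]; exact hv.continuousAt.eventually h2⟩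

theorem IsPrimitiveAlong.add_const (h : θ.IsPrimitiveAlong u F S) (c : ℝ) :
    θ.IsPrimitiveAlong u (fun x => F x + c) S := fun x hx => by
  obtain ⟨φ, h1, h2⟩ := h x hx
  refine ⟨_, h1.add_const c, ?_⟩
  filter_upwards [h2] with y hy
  simp [hy]

theorem IsPrimitiveAlong.congr (h : θ.IsPrimitiveAlong u F S) (hF : EqOn F' F S) :
    θ.IsPrimitiveAlong u F' S := fun x hx =>
  let ⟨φ, h1, h2⟩ := h x hx
  ⟨φ, h1, hF.eventuallyEq_nhdsWithin.trans h2⟩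

/-- Two local primitives of `θ` differ by a constant, so `F - F'` is locally constant on the
preconnected set `S`. -/
theorem IsPrimitiveAlong.sub_eq_sub (hS : IsPreconnected S) (hu : ContinuousOn u S)
    (h : θ.IsPrimitiveAlong u F S) (h' : θ.IsPrimitiveAlong u F' S) {x y : X} (hx : x ∈ S)
    (hy : y ∈ S) : F y - F' y = F x - F' x := by
  refine hS.eq_of_eventually_eq (h := fun z => F z - F' z) (fun z hz => ?_) hx hy
  obtain ⟨φ, h1, h2⟩ := h z hz
  obtain ⟨ψ, h3, h4⟩ := h' z hz
  have h5 := (hu z hz).eventually (h1.eventually_sub_eq h3)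
  have h6 := h2.self_of_nhdsWithin hz
  have h7 := h4.self_of_nhdsWithin hz
  filter_upwards [h2, h4, h5] with w hw hw' hw''
  rw [hw, hw', h6, h7]
  exact hw''

/-- Primitives along a map on two closed sets that agree on the intersection glue. -/
theorem IsPrimitiveAlong.union (hS : IsClosed S) (hT : IsClosed T) (hu : Continuous u)
    (hFS : θ.IsPrimitiveAlong u F S) (hFT : θ.IsPrimitiveAlong u F T) :
    θ.IsPrimitiveAlong u F (S ∪ T) := by
  intro x hx
  by_cases hxS : x ∈ S
  · obtain ⟨φ, h1, h2⟩ := hFS x hxS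
    refine ⟨φ, h1, ?_⟩
    rw [nhdsWithin_union]
    refine eventually_sup.2 ⟨h2, ?_⟩
    by_cases hxT : x ∈ T
    · obtain ⟨ψ, h3, h4⟩ := hFT x hxT
      -- Both local primitives take the value `F x` at `u x`, so their locally constant difference
      -- is zero and either one represents `F` on both sets.
      have h5 := hu.continuousAt.eventually (h1.eventually_sub_eq h3)
      have h6 : F x = φ (u x) := h2.self_of_nhdsWithin hxS
      have h7 : F x = ψ (u x) := h4.self_of_nhdsWithin hxT
      filter_upwards [h4, nhdsWithin_le_nhds h5] with w hw hw'
      rw [← h6, ← h7, sub_self, sub_eq_zero] at hw'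
      rw [hw]
      exact hw'.symm
    -- Away from the closed set `T` there is nothing to check: `𝓝[T] x` is trivial.
    · rw [notMem_closure_iff_nhdsWithin_eq_bot.1 (by rwa [hT.closure_eq])]
      exact eventually_bot
  · obtain ⟨φ, h1, h2⟩ := hFT x (hx.resolve_left hxS)
    refine ⟨φ, h1, ?_⟩
    rw [nhdsWithin_union]
    refine eventually_sup.2 ⟨?_, h2⟩
    rw [notMem_closure_iff_nhdsWithin_eq_bot.1 (by rwa [hS.closure_eq])]
    exact eventually_bot

/-- On the preconnected overlap the two primitives differ by one constant; shifting the second by it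
makes them agree there. If the overlap is empty, any shift works. -/
theorem exists_isPrimitiveAlong_union (hS : IsClosed S) (hT : IsClosed T)
    (hST : IsPreconnected (S ∩ T)) (hu : Continuous u) (hFS : ∃ F, θ.IsPrimitiveAlong u F S)
    (hFT : ∃ F, θ.IsPrimitiveAlong u F T) : ∃ F, θ.IsPrimitiveAlong u F (S ∪ T) := by
  classical
  obtain ⟨F, hF⟩ := hFS
  obtain ⟨F', hF'⟩ := hFT
  obtain ⟨c, hc⟩ : ∃ c, ∀ x ∈ S ∩ T, F x = F' x + c := by
    rcases (S ∩ T).eq_empty_or_nonempty with h | ⟨x, hx⟩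
    · exact ⟨0, by simp [h]⟩
    · refine ⟨F x - F' x, fun y hy => ?_⟩
      have := IsPrimitiveAlong.sub_eq_sub hST hu.continuousOn (hF.mono inter_subset_left)
        (hF'.mono inter_subset_right) hx hy
      linarith
  refine ⟨S.piecewise F fun x => F' x + c, .union hS hT hu (hF.congr (piecewise_eqOn _ _ _))
    ((hF'.add_const c).congr fun x hx => ?_)⟩
  by_cases hxS : x ∈ S
  · simp [hxS, hc x ⟨hxS, hx⟩]
  · simp [hxS]

end Along

/-! ### Primitives over the unit square and integrals along continuous paths -/

section Square

variable {θ : OneForm EM M}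

open unitInterval

/-- A closed 1-form has a primitive along every continuous map from the unit square. -/
theorem IsClosedForm.exists_isPrimitiveAlong (hθ : θ.IsClosedForm) (D : C(I × I, M)) :
    ∃ F, θ.IsPrimitiveAlong D F univ := by
  choose φ hφ using hθ.exists_isPrimitiveAt
  have hex : ∀ x, ∃ U ⊆ {y | θ.IsPrimitiveAt (φ x) y}, IsOpen U ∧ x ∈ U := fun x =>
    mem_nhds_iff.1 (hφ x).eventually
  choose U hU hUo hxU using hex
  -- A grid so fine that `D` maps each cell into a set carrying a single primitive. Cells are glued
  -- into rows and rows into the square; each overlap is a product of intervals, hence preconnected.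
  obtain ⟨t, t0, tm, ⟨n, hn⟩, hc⟩ := exists_monotone_Icc_subset_open_cover_unitInterval_prod_self
    (c := fun x => D ⁻¹' U x) (fun x => (hUo x).preimage D.continuous)
    (fun p _ => mem_iUnion.2 ⟨D p, hxU _⟩)
  have hcell : ∀ n m, ∃ F, θ.IsPrimitiveAlong D F
      (Icc (t n) (t (n + 1)) ×ˢ Icc (t m) (t (m + 1))) := by
    intro n m
    obtain ⟨x, hx⟩ := hc n m
    exact ⟨φ x ∘ D, fun p hp => ⟨φ x, hU x (hx hp), EventuallyEq.rfl⟩⟩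
  have hIcc : ∀ a b : I, IsPreconnected (Icc a b) := fun a b => isPreconnected_Icc
  have ht0 : ∀ k, t 0 ≤ t k := fun k => tm (Nat.zero_le k)
  have hrow : ∀ m k, ∃ F, θ.IsPrimitiveAlong D F
      (Icc (t 0) (t k) ×ˢ Icc (t m) (t (m + 1))) := by
    intro m k
    induction k with
    | zero =>
      obtain ⟨F, hF⟩ := hcell 0 m
      -- The degenerate row over `[t 0, t 0]` lies in the first cell.
      exact ⟨F, hF.mono (prod_mono_left (Icc_subset_Icc_right (ht0 1)))⟩
    | succ k ih =>
      have h := exists_isPrimitiveAlong_union (isClosed_Icc.prod isClosed_Icc)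
        (isClosed_Icc.prod isClosed_Icc) ?_ D.continuous ih (hcell k m)
      · rwa [← union_prod, Icc_union_Icc_eq_Icc (ht0 k) (tm k.le_succ)] at h
      · rw [prod_inter_prod, Icc_inter_Icc, Icc_inter_Icc]
        exact (hIcc _ _).prod (hIcc _ _)
  have hall : ∀ k, ∃ F, θ.IsPrimitiveAlong D F (Icc (t 0) (t n) ×ˢ Icc (t 0) (t k)) := by
    intro k
    induction k with
    | zero =>
      obtain ⟨F, hF⟩ := hrow 0 n
      exact ⟨F, hF.mono (prod_mono_right (Icc_subset_Icc_right (ht0 1)))⟩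
    | succ k ih =>
      have h := exists_isPrimitiveAlong_union (isClosed_Icc.prod isClosed_Icc)
        (isClosed_Icc.prod isClosed_Icc) ?_ D.continuous ih (hrow k n)
      · rwa [← prod_union, Icc_union_Icc_eq_Icc (ht0 k) (tm k.le_succ)] at h
      · rw [prod_inter_prod, Icc_inter_Icc, Icc_inter_Icc]
        exact (hIcc _ _).prod (hIcc _ _)
  obtain ⟨F, hF⟩ := hall n
  refine ⟨F, hF.mono fun p _ => ?_⟩
  rw [t0, hn n le_rfl]
  exact ⟨⟨unitInterval.nonneg', unitInterval.le_one'⟩,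
    ⟨unitInterval.nonneg', unitInterval.le_one'⟩⟩

theorem IsClosedForm.exists_isPrimitiveAlong_path (hθ : θ.IsClosedForm) (γ : C(I, M)) :
    ∃ F, θ.IsPrimitiveAlong γ F univ := by
  -- The path is read as a square that is constant in the first variable, then restricted to one
  -- edge.
  obtain ⟨F, hF⟩ := hθ.exists_isPrimitiveAlong (γ.comp ⟨Prod.snd, continuous_snd⟩)
  exact ⟨_, hF.comp (v := fun t : I => ((0 : I), t)) (by fun_prop)⟩

open Classical in
/-- The integral of a closed 1-form along a continuous path. -/
def pathIntegral (θ : OneForm EM M) (γ : C(I, M)) : ℝ :=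
  if h : ∃ F, θ.IsPrimitiveAlong γ F univ then h.choose 1 - h.choose 0 else 0

/-- The increment does not depend on the chosen primitive, because two primitives along a path
differ by a constant. -/
theorem IsPrimitiveAlong.pathIntegral_eq {γ : C(I, M)} {F : I → ℝ}
    (hF : θ.IsPrimitiveAlong γ F univ) : θ.pathIntegral γ = F 1 - F 0 := by
  have h : ∃ F, θ.IsPrimitiveAlong γ F univ := ⟨F, hF⟩
  rw [pathIntegral, dif_pos h]
  have := IsPrimitiveAlong.sub_eq_sub isPreconnected_univ γ.continuous.continuousOn h.choose_spec
    hF (mem_univ 0) (mem_univ 1)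
  linarith

theorem pathIntegral_eq_of_isPrimitiveAt {γ : C(I, M)} {φ : M → ℝ}
    (h : ∀ τ, θ.IsPrimitiveAt φ (γ τ)) : θ.pathIntegral γ = φ (γ 1) - φ (γ 0) :=
  IsPrimitiveAlong.pathIntegral_eq (F := φ ∘ γ) fun τ _ => ⟨φ, h τ, EventuallyEq.rfl⟩

theorem IsClosedForm.pathIntegral_of_forall_eq (hθ : θ.IsClosedForm) {γ : C(I, M)}
    (h : ∀ τ, γ τ = γ 0) : θ.pathIntegral γ = 0 := by
  obtain ⟨φ, hφ⟩ := hθ.exists_isPrimitiveAt (γ 0)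
  rw [pathIntegral_eq_of_isPrimitiveAt (φ := φ) fun τ => by rwa [h τ], h 1, sub_self]

theorem IsClosedForm.pathIntegral_concatPath (hθ : θ.IsClosedForm) {γ δ : C(I, M)}
    (h : γ 1 = δ 0) :
    θ.pathIntegral (concatPath γ δ h) = θ.pathIntegral γ + θ.pathIntegral δ := by
  obtain ⟨F, hF⟩ := hθ.exists_isPrimitiveAlong_path (concatPath γ δ h)
  -- `a` and `b` parametrize the two halves of `[0,1]`; one primitive along the concatenation
  -- restricts to primitives along `γ` and `δ`.
  set a : I → I := fun t => ⟨t / 2, by constructor <;> linarith [t.2.1, t.2.2]⟩ with ha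
  set b : I → I := fun t => ⟨(t + 1) / 2, by constructor <;> linarith [t.2.1, t.2.2]⟩ with hb
  have hac : Continuous a := by fun_prop
  have hbc : Continuous b := by fun_prop
  have h1 : concatPath γ δ h ∘ a = γ := by
    funext t
    have h2 : ((a t : I) : ℝ) ≤ 1 / 2 := by simp only [ha]; linarith [t.2.2]
    simp only [concatPath, Function.comp, ha]
    change (Path.trans _ _) _ = _
    rw [Path.trans_apply, dif_pos h2]
    change γ _ = _
    congr 1
    ext
    simp only
    ring
  have h2 : concatPath γ δ h ∘ b = δ := by
    funext t
    simp only [concatPath, Function.comp, hb]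
    change (Path.trans _ _) _ = _
    rw [Path.trans_apply]
    split_ifs with h3
    -- At the junction `1/2` the concatenation is evaluated by its first branch, so `γ 1 = δ 0` is
    -- needed.
    · have h4 : t = 0 := by
        ext
        simp only at h3
        have := t.2.1
        simp only [Icc.coe_zero]
        linarith
      subst h4
      change γ _ = _
      rw [← h]
      congr 1
      ext
      simp
    · change δ _ = _
      congr 1
      ext
      simp only
      ring
  have hFa := hF.comp hac
  have hFb := hF.comp hbc
  rw [h1] at hFa
  rw [h2] at hFb
  rw [hF.pathIntegral_eq, hFa.pathIntegral_eq, hFb.pathIntegral_eq]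
  have ha0 : a 0 = 0 := by ext; simp [ha]
  have hb1 : b 1 = 1 := by ext; simp [hb]
  have hab : a 1 = b 0 := by ext; simp [ha, hb]
  simp only [Function.comp, ha0, hb1, hab]
  ring

end Square

end OneForm

/-! ### Operations on `G`-paths -/

namespace LieGroupoid

variable {EM EG M G : Type*}
  [NormedAddCommGroup EM] [NormedSpace ℝ EM] [NormedAddCommGroup EG] [NormedSpace ℝ EG]
  [TopologicalSpace M] [ChartedSpace EM M] [TopologicalSpace G] [ChartedSpace EG G]
  {𝒢 : LieGroupoid EM EG M G}

theorem isPiecewiseSmooth_const (x : M) :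
    IsPiecewiseSmooth EM (ContinuousMap.const unitInterval x) :=
  ⟨∅, fun _ _ _ _ _ _ => contMDiffOn_const⟩

theorem IsChain.append {p x y : M} {A B : List (G × C(unitInterval, M))} (hA : 𝒢.IsChain p A x)
    (hB : 𝒢.IsChain x B y) : 𝒢.IsChain p (A ++ B) y := by
  induction A generalizing p with
  | nil =>
    obtain rfl : p = x := hA
    exact hB
  | cons q A ih => exact ⟨hA.1, hA.2.1, ih hA.2.2⟩

/-- The constant `G`-path. -/
def GPath.const (𝒢 : LieGroupoid EM EG M G) (x : M) : 𝒢.GPath x x :=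
  ⟨⟨ContinuousMap.const unitInterval x, []⟩, ⟨rfl, rfl⟩, isPiecewiseSmooth_const x, by simp⟩

/-- Continue a `G`-path by an arrow and a path. -/
def GPath.snoc {x y : M} (σ : 𝒢.GPath x y) (g : G) (hg : 𝒢.src g = y)
    (γ : C(unitInterval, M)) (hγ : IsPiecewiseSmooth EM γ) (hγg : 𝒢.tgt g = γ 0) :
    𝒢.GPath x (γ 1) :=
  ⟨⟨σ.1.head, σ.1.tail ++ [(g, γ)]⟩, ⟨σ.2.1.1, σ.2.1.2.append ⟨hg, hγg, rfl⟩⟩, σ.2.2.1, by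
    intro p hp
    rcases List.mem_append.1 hp with h | h
    · exact σ.2.2.2 p h
    · rw [List.mem_singleton.1 h]
      exact hγ⟩

/-- The concatenation of `G`-paths: first `σ`, then `σ'`. -/
def GPath.trans {x y z : M} (σ : 𝒢.GPath x y) (σ' : 𝒢.GPath y z) : 𝒢.GPath x z :=
  ⟨⟨σ.1.head, σ.1.tail ++ (𝒢.unit y, σ'.1.head) :: σ'.1.tail⟩,
    ⟨σ.2.1.1, σ.2.1.2.append ⟨𝒢.src_unit y, (𝒢.tgt_unit y).trans σ'.2.1.1.symm, σ'.2.1.2⟩⟩,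
    σ.2.2.1, by
    intro p hp
    rcases List.mem_append.1 hp with h | h
    · exact σ.2.2.2 p h
    · rcases List.mem_cons.1 h with rfl | h
      · exact σ'.2.2.1
      · exact σ'.2.2.2 p h⟩

/-! ### Integrals along `G`-paths and their homotopy invariance -/

variable [IsManifold 𝓘(ℝ, EM) ∞ M] {θ : OneForm EM M}

/-- The integral of a 1-form along a chain of paths and arrows; the arrows do not contribute. -/
def RawPath.integral (σ : RawPath M G) (θ : OneForm EM M) : ℝ :=
  θ.pathIntegral σ.head + (σ.tail.map fun p => θ.pathIntegral p.2).sum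

/-- Arrows do not count, constant paths have integral zero, and the integral is additive under
concatenation. -/
theorem ElemEquiv.integral_eq (hθ : θ.IsClosedForm) {σ σ' : RawPath M G}
    (h : 𝒢.ElemEquiv σ σ') : σ.integral θ = σ'.integral θ := by
  cases h with
  | mul σ₀ A g₁ c g₂ σ B hc => simp [RawPath.integral, hθ.pathIntegral_of_forall_eq hc]
  | concat_head σ₀ σ₁ B h => simp [RawPath.integral, hθ.pathIntegral_concatPath, add_assoc]
  | concat_tail σ₀ A g σ σ' B h => simp [RawPath.integral, hθ.pathIntegral_concatPath, add_assoc]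

/-- Primitives of a basic form along the source and the target of a path of arrows differ by a
constant. -/
theorem IsBasicForm.sub_eq_sub [IsManifold 𝓘(ℝ, EG) ∞ G] (hθ : 𝒢.IsBasicForm θ)
    (d : C(unitInterval, G)) {P Q : unitInterval → ℝ}
    (hP : θ.IsPrimitiveAlong (fun τ => 𝒢.src (d τ)) P univ)
    (hQ : θ.IsPrimitiveAlong (fun τ => 𝒢.tgt (d τ)) Q univ) : P 1 - Q 1 = P 0 - Q 0 := by
  refine isPreconnected_univ.eq_of_eventually_eq (h := fun τ => P τ - Q τ) (fun τ _ => ?_)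
    (mem_univ 0) (mem_univ 1)
  obtain ⟨φ, hφ, hPφ⟩ := hP τ (mem_univ τ)
  obtain ⟨ψ, hψ, hQψ⟩ := hQ τ (mem_univ τ)
  have h1 : ∀ᶠ g in 𝓝 (d τ), HasMFDerivAt 𝓘(ℝ, EG) 𝓘(ℝ, ℝ) (φ ∘ 𝒢.src) g
      ((θ.eval (𝒢.src g)).comp (mfderiv 𝓘(ℝ, EG) 𝓘(ℝ, EM) 𝒢.src g)) := by
    filter_upwards [𝒢.smooth_src.continuous.continuousAt.eventually hφ] with g hg
    exact hg.comp g (𝒢.smooth_src.mdifferentiableAt (by simp)).hasMFDerivAt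
  -- By basicness the pullbacks of the two local primitives along source and target have the same
  -- differential on `G`, so they differ by a constant near `d τ`.
  have h2 : ∀ᶠ g in 𝓝 (d τ), HasMFDerivAt 𝓘(ℝ, EG) 𝓘(ℝ, ℝ) (ψ ∘ 𝒢.tgt) g
      ((θ.eval (𝒢.src g)).comp (mfderiv 𝓘(ℝ, EG) 𝓘(ℝ, EM) 𝒢.src g)) := by
    filter_upwards [𝒢.smooth_tgt.continuous.continuousAt.eventually hψ] with g hg
    have h := hg.comp g (𝒢.smooth_tgt.mdifferentiableAt (by simp)).hasMFDerivAt
    exact (hθ g).symm ▸ h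
  have h3 := d.continuous.continuousAt.eventually (eventually_sub_eq_of_hasMFDerivAt h1 h2)
  have h4 := hPφ.self_of_nhdsWithin (mem_univ τ)
  have h5 := hQψ.self_of_nhdsWithin (mem_univ τ)
  filter_upwards [hPφ, hQψ, nhdsWithin_le_nhds h3] with ν hν hν' hν''
  rw [hν, hν', h4, h5]
  exact hν''

/-- The telescoping argument. `P` records how the starting point `p` of the remaining chain moves;
each arrow transfers this variation to the edge `D(·,0)`, and the path integral carries it on to
`D(·,1)`, the next starting curve. At the end of the chain the point is fixed at `y`, so no
variation is left. -/
theorem IsBasicForm.add_sum_pathIntegral_eq [IsManifold 𝓘(ℝ, EG) ∞ G] (hθ : 𝒢.IsBasicForm θ)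
    (hcl : θ.IsClosedForm) (y : M)
    (L : List (C(unitInterval, G) × C(unitInterval × unitInterval, M))) (p : C(unitInterval, M))
    {P : unitInterval → ℝ}
    (hP : θ.IsPrimitiveAlong p P univ)
    (hL : ∀ τ, 𝒢.IsChain (p τ) (L.map fun q => (q.1 τ, q.2.curry τ)) y) :
    P 1 + (L.map fun q => θ.pathIntegral (q.2.curry 1)).sum =
      P 0 + (L.map fun q => θ.pathIntegral (q.2.curry 0)).sum := by
  induction L generalizing p P with
  | nil =>
    have hp : ∀ τ, p τ = p 0 := fun τ => (hL τ).trans (hL 0).symm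
    have := hP.pathIntegral_eq
    rw [hcl.pathIntegral_of_forall_eq hp] at this
    simp only [List.map_nil, List.sum_nil]
    linarith
  | cons q L ih =>
    obtain ⟨d, D⟩ := q
    obtain ⟨F, hF⟩ := hcl.exists_isPrimitiveAlong D
    have hs : ∀ τ, θ.pathIntegral (D.curry τ) = F (τ, 1) - F (τ, 0) := fun τ =>
      (hF.comp (v := fun ν : unitInterval => (τ, ν)) (by fun_prop)).pathIntegral_eq (γ := D.curry τ)
    have hF0 := hF.comp (v := fun τ : unitInterval => (τ, (0 : unitInterval))) (by fun_prop)
    have hF1 := hF.comp (v := fun τ : unitInterval => (τ, (1 : unitInterval))) (by fun_prop)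
    have hsrc : (fun τ => 𝒢.src (d τ)) = p := funext fun τ => (hL τ).1
    have htgt : (fun τ => 𝒢.tgt (d τ)) = D ∘ fun τ : unitInterval => (τ, (0 : unitInterval)) :=
      funext fun τ => (hL τ).2.1
    have h1 := hθ.sub_eq_sub d (hsrc ▸ hP) (htgt ▸ hF0)
    have h2 := ih (D.comp ⟨fun τ : unitInterval => (τ, (1 : unitInterval)), by fun_prop⟩) hF1
      fun τ => (hL τ).2.2
    simp only [Function.comp] at h1 h2
    simp only [List.map_cons, List.sum_cons, hs]
    linarith

theorem IsDeformation.integral_eq [IsManifold 𝓘(ℝ, EG) ∞ G] (hθ : 𝒢.IsBasicForm θ)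
    (hcl : θ.IsClosedForm) {x y : M} {D : RawFamily M G} {σ σ' : RawPath M G}
    (h : 𝒢.IsDeformation x y D σ σ') : σ.integral θ = σ'.integral θ := by
  obtain ⟨hD, rfl, rfl⟩ := h
  obtain ⟨F, hF⟩ := hcl.exists_isPrimitiveAlong D.head
  have hs : ∀ τ, θ.pathIntegral (D.head.curry τ) = F (τ, 1) - F (τ, 0) := fun τ =>
    (hF.comp (v := fun ν : unitInterval => (τ, ν)) (by fun_prop)).pathIntegral_eq
      (γ := D.head.curry τ)
  have hF0 := hF.comp (v := fun τ : unitInterval => (τ, (0 : unitInterval))) (by fun_prop)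
  have hF1 := hF.comp (v := fun τ : unitInterval => (τ, (1 : unitInterval))) (by fun_prop)
  have h0 : ∀ τ, D.head (τ, 0) = D.head (0, 0) := fun τ => (hD τ).1.trans (hD 0).1.symm
  -- The initial edge is constant at `x`, so `F(0,0) = F(1,0)`.
  have h1 := hF0.pathIntegral_eq
    (γ := D.head.comp ⟨fun τ : unitInterval => (τ, (0 : unitInterval)), by fun_prop⟩)
  rw [hcl.pathIntegral_of_forall_eq h0] at h1
  have h2 := hθ.add_sum_pathIntegral_eq hcl y D.tail
    (D.head.comp ⟨fun τ : unitInterval => (τ, (1 : unitInterval)), by fun_prop⟩) hF1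
    fun τ => (hD τ).2
  simp only [Function.comp] at h1 h2
  simp only [RawPath.integral, RawFamily.slice, hs, List.map_map, Function.comp_def]
  linarith

theorem GHomotopic.integral_eq [IsManifold 𝓘(ℝ, EG) ∞ G] (hθ : 𝒢.IsBasicForm θ)
    (hcl : θ.IsClosedForm) {x y : M} {σ σ' : 𝒢.GPath x y} (h : (𝒢.GHomotopic x y).r σ σ') :
    σ.1.integral θ = σ'.1.integral θ := by
  induction h with
  | rel σ σ' h =>
    rcases h with h | ⟨D, hD⟩
    · exact h.integral_eq hcl
    · exact hD.integral_eq hθ hcl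
  | refl => rfl
  | symm _ _ _ ih => exact ih.symm
  | trans _ _ _ _ _ ih ih' => exact ih.trans ih'

theorem GPath.integral_const (hcl : θ.IsClosedForm) (x : M) :
    (GPath.const 𝒢 x).1.integral θ = 0 := by
  simp only [GPath.const, RawPath.integral, List.map_nil, List.sum_nil, add_zero]
  exact hcl.pathIntegral_of_forall_eq fun _ => rfl

theorem GPath.integral_snoc {x y : M} (σ : 𝒢.GPath x y) (g : G) (hg : 𝒢.src g = y)
    (γ : C(unitInterval, M)) (hγ : IsPiecewiseSmooth EM γ) (hγg : 𝒢.tgt g = γ 0) :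
    (σ.snoc g hg γ hγ hγg).1.integral θ = σ.1.integral θ + θ.pathIntegral γ := by
  simp [GPath.snoc, RawPath.integral, add_assoc]

theorem GPath.integral_trans {x y z : M} (σ : 𝒢.GPath x y) (σ' : 𝒢.GPath y z) :
    (σ.trans σ').1.integral θ = σ.1.integral θ + σ'.1.integral θ := by
  simp [GPath.trans, RawPath.integral, add_assoc]

/-! ### Path independence and the global basic primitive -/

/-- On a simply `G`-connected groupoid, the integral of a closed basic 1-form along `G`-paths
depends only on the end points. -/
theorem SimplyGConnected.integral_eq [IsManifold 𝓘(ℝ, EG) ∞ G] (h𝒢 : 𝒢.SimplyGConnected)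
    (hθ : 𝒢.IsBasicForm θ) (hcl : θ.IsClosedForm) {x y : M} (σ σ' : 𝒢.GPath x y) :
    σ.1.integral θ = σ'.1.integral θ := by
  -- A fixed return path closes both `G`-paths to loops, whose integrals vanish.
  obtain ⟨ρ⟩ := h𝒢.1 y x
  have hloop : ∀ σ : 𝒢.GPath x y, σ.1.integral θ + ρ.1.integral θ = 0 := fun σ => by
    have h := (h𝒢.2 x).elim (Quotient.mk (𝒢.GHomotopic x x) (σ.trans ρ))
      (Quotient.mk (𝒢.GHomotopic x x) (GPath.const 𝒢 x))
    rw [← GPath.integral_trans, GHomotopic.integral_eq hθ hcl (Quotient.exact h),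
      GPath.integral_const hcl]
  linarith [hloop σ, hloop σ']

/-- On a simply `G`-connected groupoid, closed basic 1-forms are differentials of smooth basic
functions. -/
theorem SimplyGConnected.exists_isBasicFun [IsManifold 𝓘(ℝ, EG) ∞ G] (h𝒢 : 𝒢.SimplyGConnected)
    (hθ : 𝒢.IsBasicForm θ) (hcl : θ.IsClosedForm) :
    ∃ f : M → ℝ, ContMDiff 𝓘(ℝ, EM) 𝓘(ℝ, ℝ) ∞ f ∧ 𝒢.IsBasicFun f ∧
      ∀ x, θ.eval x = mfderiv 𝓘(ℝ, EM) 𝓘(ℝ, ℝ) f x := by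
  rcases isEmpty_or_nonempty M with hM | ⟨⟨x₀⟩⟩
  · exact ⟨fun _ => 0, contMDiff_const, fun g => isEmptyElim (𝒢.src g), fun x => isEmptyElim x⟩
  set f : M → ℝ := fun x => (h𝒢.1 x₀ x).some.1.integral θ with hf
  have hfσ : ∀ {x : M} (σ : 𝒢.GPath x₀ x), f x = σ.1.integral θ := fun σ =>
    h𝒢.integral_eq hθ hcl _ σ
  have hd : ∀ x, HasMFDerivAt 𝓘(ℝ, EM) 𝓘(ℝ, ℝ) f x (θ.eval x) := by
    intro x
    obtain ⟨φ, hφ⟩ := hcl.exists_isPrimitiveAt x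
    -- Near `x`, `f` equals the local primitive `φ` shifted to have the value `f x` at `x`: nearby
    -- points are reached by appending a unit arrow and a short path on which `φ` computes the
    -- integral.
    have h1 := (hφ.add_const (f x - φ x)).self_of_nhds
    refine h1.congr_of_eventuallyEq ?_
    filter_upwards [eventually_exists_isPiecewiseSmooth (E := EM) hφ.eventually] with y hy
    obtain ⟨γ, hγ, h0, rfl, hγφ⟩ := hy
    rw [hfσ ((h𝒢.1 x₀ x).some.snoc (𝒢.unit x) (𝒢.src_unit x) γ hγ ((𝒢.tgt_unit x).trans h0.symm)),
      GPath.integral_snoc, OneForm.pathIntegral_eq_of_isPrimitiveAt hγφ, h0]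
    ring
  refine ⟨f, OneForm.contMDiff_of_hasMFDerivAt hd, fun g => ?_, fun x => (hd x).mfderiv.symm⟩
  -- Appending `g` and a constant path to a `G`-path ending at the source of `g` leaves the integral
  -- unchanged.
  have h : f (𝒢.tgt g) =
      f (𝒢.src g) + θ.pathIntegral (ContinuousMap.const unitInterval (𝒢.tgt g)) :=
    (hfσ ((h𝒢.1 x₀ (𝒢.src g)).some.snoc g rfl (ContinuousMap.const unitInterval (𝒢.tgt g))
      (isPiecewiseSmooth_const _) rfl)).trans (GPath.integral_snoc _ g rfl _ _ rfl)
  rw [hcl.pathIntegral_of_forall_eq fun _ => rfl, add_zero] at h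
  exact h.symm

end LieGroupoid

end

theorem mainTheorem9 {EM EG M G : Type*}
    [NormedAddCommGroup EM] [NormedSpace ℝ EM] [FiniteDimensional ℝ EM]
    [NormedAddCommGroup EG] [NormedSpace ℝ EG] [FiniteDimensional ℝ EG]
    [TopologicalSpace M] [ChartedSpace EM M] [IsManifold 𝓘(ℝ, EM) ∞ M]
    [TopologicalSpace G] [ChartedSpace EG G] [IsManifold 𝓘(ℝ, EG) ∞ G]
    (𝒢 : LieGroupoid EM EG M G) (h𝒢 : 𝒢.SimplyGConnected) :
    Subsingleton 𝒢.BasicH1 := by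
  rw [Submodule.Quotient.subsingleton_iff, eq_top_iff]
  exact fun θ _ => h𝒢.exists_isBasicFun θ.2.1 θ.2.2
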